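/- Let $V$ be a finite set and let $\mathcal{C}=(V,\mathcal{R})$ be a coherent configuration (scheme), not necessarily homogeneous: $\mathcal{R}$ is a set of nonempty binary relations on $V$ that partitions $V\times V$, the diagonal of $V\times V$ is a union of elements of $\mathcal{R}$, $R^t=\{(v,u):(u,v)\in R\}\in\mathcal{R}$ for every $R\in\mathcal{R}$, and for all $R,S,T\in\mathcal{R}$ the number $|\{v\in V:(u,v)\in R,\ (v,w)\in S\}|$ is the same for all $(u,w)\in T$. Let $W\subseteq \mathrm{Mat}_V(\mathbb{Z})$ be the adjacency ring of $\mathcal{C}$, that is, the $\mathbb{Z}$-span of the adjacency matrices $A(R)$, $R\in\mathcal{R}$, and for a field $k$ let $W^k=k\otimes_{\mathbb{Z}}W$ be the adjacency algebra over $k$. Let $M_1,\dots,M_r$ be representatives of the isomorphism classes of irreducible right $W^{\mathbb{C}}$-modules, let $f_i=\dim_{\mathbb{C}}M_i$, and let $m_i$ be the multiplicity of $M_i$ in the standard module $\mathbb{C}V$, on which $W^{\mathbb{C}}$ acts from the right by $uA=\sum_{v\in V}A_{u,v}\,v$, so that $\mathbb{C}V\cong\bigoplus_{i=1}^r m_iM_i$.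 Then the Frame number $$\mathcal{F}(\mathcal{C})=\frac{\prod_{R\in\mathcal{R}}|R|}{\prod_{i=1}^r m_i^{f_i^2}}$$ is an integer, and for every field $k$ of characteristic $p$ (with $p$ a prime or $p=0$) the algebra $W^k$ is semisimple if and only if $p$ does not divide $\mathcal{F}(\mathcal{C})$. -/

import Mathlib

open scoped TensorProduct Matrix

/-- A coherent configuration (scheme) on a finite set `V`. -/
structure CoherentConfiguration (V : Type*) [Fintype V] [DecidableEq V] where
  /-- the set of basis relations -/
  rels : Finset (Finset (V × V))
  nonempty_of_mem : ∀ R ∈ rels, R.Nonempty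
  /-- the basis relations partition `V × V` -/
  existsUnique_mem : ∀ x : V × V, ∃! R, R ∈ rels ∧ x ∈ R
  /-- the diagonal is a union of basis relations -/
  diag_eq_union : ∃ D ⊆ rels, D.biUnion id = (Finset.univ : Finset V).diag
  transpose_mem : ∀ R ∈ rels, R.image Prod.swap ∈ rels
  /-- the intersection numbers are well defined -/
  coherent : ∀ R ∈ rels, ∀ S ∈ rels, ∀ T ∈ rels, ∀ u w u' w' : V,
    (u, w) ∈ T → (u', w') ∈ T →
      (Finset.univ.filter fun v => (u, v) ∈ R ∧ (v, w) ∈ S).card =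
        (Finset.univ.filter fun v => (u', v) ∈ R ∧ (v, w') ∈ S).card

/-- The adjacency matrix of a binary relation. -/
def adjacencyMatrix {V : Type*} [DecidableEq V] (R : Finset (V × V)) : Matrix V V ℤ :=
  Matrix.of fun u v => if (u, v) ∈ R then 1 else 0

section Modules

variable (B : Type*) [Ring B]

/-- Maximal left ideals `I`, `J` of `B` are identified when the simple modules `B ⧸ I` and `B ⧸ J`
are isomorphic. -/
def simpleModuleSetoid : Setoid {I : Submodule B B // IsCoatom I} where
  r I J := Nonempty ((B ⧸ I.1) ≃ₗ[B] (B ⧸ J.1))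
  iseqv := ⟨fun _ => ⟨LinearEquiv.refl _ _⟩, fun ⟨e⟩ => ⟨e.symm⟩, fun ⟨e⟩ ⟨f⟩ => ⟨e.trans f⟩⟩

/-- The isomorphism classes of simple left `B`-modules: every simple module is isomorphic to
`B ⧸ I` for some maximal left ideal `I`. -/
def Irr : Type _ := Quotient (simpleModuleSetoid B)

variable {B}

/-- A simple module representing a given isomorphism class. -/
abbrev Irr.Rep (i : Irr B) : Type _ := B ⧸ (Quotient.out i).1

/-- The multiplicity of a simple module in a module `N`: the number of summands in a decomposition
of the isotypic component of `N` into simple modules. -/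
noncomputable def Irr.multiplicity (i : Irr B) (N : Type*) [AddCommGroup N] [Module B N] : ℕ :=
  (Module.length B (isotypicComponent B N i.Rep)).toNat

end Modules

namespace CoherentConfiguration

variable {V : Type*} [Fintype V] [DecidableEq V] (C : CoherentConfiguration V)

/-- The `ℤ`-span of the adjacency matrices of the basis relations. -/
def adjacencyModule : Submodule ℤ (Matrix V V ℤ) :=
  Submodule.span ℤ (adjacencyMatrix '' (C.rels : Set (Finset (V × V))))

theorem mem_adjacencyModule_of_const (M : Matrix V V ℤ)
    (h : ∀ T ∈ C.rels, ∀ u w u' w' : V, (u, w) ∈ T → (u', w') ∈ T → M u w = M u' w') :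
    M ∈ C.adjacencyModule := by
  classical
  let c : Finset (V × V) → ℤ := fun T => if hT : T.Nonempty then M hT.choose.1 hT.choose.2 else 0
  have hM : M = ∑ T ∈ C.rels, c T • adjacencyMatrix T := by
    ext u w
    obtain ⟨T, ⟨hT, hx⟩, huniq⟩ := C.existsUnique_mem (u, w)
    rw [Matrix.sum_apply, Finset.sum_eq_single T]
    · have hne : T.Nonempty := ⟨_, hx⟩
      have := h T hT u w hne.choose.1 hne.choose.2 hx hne.choose_spec
      simp [c, adjacencyMatrix, hx, hne, this]
    · intro S hS hST
      have : (u, w) ∉ S := fun hS' => hST (huniq S ⟨hS, hS'⟩)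
      simp [adjacencyMatrix, this]
    · exact fun hT' => absurd hT hT'
  rw [hM]
  exact Submodule.sum_mem _ fun T hT =>
    Submodule.smul_mem _ _ (Submodule.subset_span ⟨T, hT, rfl⟩)

theorem one_mem_adjacencyModule : (1 : Matrix V V ℤ) ∈ C.adjacencyModule := by
  obtain ⟨D, hD, hdiag⟩ := C.diag_eq_union
  have key : ∀ T ∈ C.rels, ∀ u w u' w' : V, (u, w) ∈ T → (u', w') ∈ T → u = w → u' = w' := by
    rintro T hT u w u' w' h1 h2 rfl
    have : (u, u) ∈ D.biUnion id := by rw [hdiag]; simp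
    obtain ⟨S, hS, hu⟩ := Finset.mem_biUnion.1 this
    have hTS : T = S := (C.existsUnique_mem (u, u)).unique ⟨hT, h1⟩ ⟨hD hS, hu⟩
    have : (u', w') ∈ D.biUnion id := Finset.mem_biUnion.2 ⟨S, hS, by simpa [← hTS] using h2⟩
    rw [hdiag] at this
    simpa using this
  refine C.mem_adjacencyModule_of_const _ fun T hT u w u' w' h1 h2 => ?_
  have : u = w ↔ u' = w' := ⟨key T hT _ _ _ _ h1 h2, key T hT _ _ _ _ h2 h1⟩
  simp [Matrix.one_apply, this]

theorem mul_mem_adjacencyModule (M N : Matrix V V ℤ) (hM : M ∈ C.adjacencyModule)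
    (hN : N ∈ C.adjacencyModule) : M * N ∈ C.adjacencyModule := by
  have h := Submodule.mul_mem_mul hM hN
  rw [adjacencyModule, Submodule.span_mul_span] at h
  refine Submodule.span_le.2 ?_ h
  rintro _ ⟨_, ⟨R, hR, rfl⟩, _, ⟨S, hS, rfl⟩, rfl⟩
  refine C.mem_adjacencyModule_of_const _ fun T hT u w u' w' h1 h2 => ?_
  have := C.coherent R hR S hS T hT u w u' w' h1 h2
  have e : ∀ a b : V, (adjacencyMatrix R * adjacencyMatrix S) a b =
      ((Finset.univ.filter fun v => (a, v) ∈ R ∧ (v, b) ∈ S).card : ℤ) := by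
    intro a b
    simp only [Matrix.mul_apply, adjacencyMatrix, Matrix.of_apply, Finset.card_filter,
      Nat.cast_sum]
    refine Finset.sum_congr rfl fun v _ => ?_
    by_cases ha : (a, v) ∈ R <;> by_cases hb : (v, b) ∈ S <;> simp [ha, hb]
  change (adjacencyMatrix R * adjacencyMatrix S) u w = (adjacencyMatrix R * adjacencyMatrix S) u' w'
  rw [e, e, this]

/-- The adjacency ring `W` of a scheme. -/
def adjacencyRing : Subalgebra ℤ (Matrix V V ℤ) :=
  C.adjacencyModule.toSubalgebra C.one_mem_adjacencyModule C.mul_mem_adjacencyModule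

/-- The adjacency algebra `k ⊗ W` over a field `k`. -/
abbrev adjacencyAlgebra (k : Type*) [Field k] : Type _ := k ⊗[ℤ] C.adjacencyRing

/-- The natural map `k ⊗ W → Mat_V(k)`. -/
noncomputable def toMatrix (k : Type*) [Field k] :
    C.adjacencyAlgebra k →ₐ[k] Matrix V V k :=
  Algebra.TensorProduct.lift (Algebra.ofId k (Matrix V V k))
    ((AlgHom.mapMatrix (Algebra.ofId ℤ k)).comp C.adjacencyRing.val)
    (fun a _ => by
      rw [Algebra.ofId_apply]
      exact Algebra.commute_algebraMap_left a _)

/-- The standard module `kV`, with basis `V`. -/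
def StandardModule (_ : CoherentConfiguration V) (k : Type*) [Field k] : Type _ := V → k

noncomputable instance (k : Type*) [Field k] : AddCommGroup (C.StandardModule k) :=
  inferInstanceAs (AddCommGroup (V → k))

/-- `kV` is a right module over the adjacency algebra (a left module over the opposite algebra):
a matrix `A` sends the basis element `u` to `∑ v, A u v • v`. -/
noncomputable instance (k : Type*) [Field k] :
    Module (C.adjacencyAlgebra k)ᵐᵒᵖ (C.StandardModule k) where
  smul a x := Matrix.vecMul (show V → k from x) (C.toMatrix k a.unop)
  one_smul x := by
    change Matrix.vecMul (show V → k from x) (C.toMatrix k 1) = x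
    rw [map_one]; exact Matrix.vecMul_one _
  mul_smul a b x := by
    change Matrix.vecMul (show V → k from x) (C.toMatrix k (b.unop * a.unop)) =
      Matrix.vecMul (Matrix.vecMul (show V → k from x) (C.toMatrix k b.unop)) (C.toMatrix k a.unop)
    rw [map_mul, Matrix.vecMul_vecMul]
  smul_zero a := Matrix.zero_vecMul _
  smul_add a x y := Matrix.add_vecMul _ _ _
  add_smul a b x := by
    change Matrix.vecMul (show V → k from x) (C.toMatrix k (a.unop + b.unop)) = _
    rw [map_add]; exact Matrix.vecMul_add _ _ _
  zero_smul x := by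
    change Matrix.vecMul (show V → k from x) (C.toMatrix k 0) = _
    rw [map_zero]; exact Matrix.vecMul_zero _

/-- The Frame number `∏ |R| / ∏ mᵢ ^ (fᵢ ^ 2)`, where `i` runs over the isomorphism classes of
irreducible right modules of the adjacency algebra over `ℂ` (there are finitely many), `fᵢ` is the
dimension and `mᵢ` the multiplicity in the standard module. -/
noncomputable def frameNumber : ℚ :=
  (∏ R ∈ C.rels, (R.card : ℚ)) /
    ∏ᶠ i : Irr (C.adjacencyAlgebra ℂ)ᵐᵒᵖ,
      (i.multiplicity (C.StandardModule ℂ) : ℚ) ^ (Module.finrank ℂ i.Rep) ^ 2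

end CoherentConfiguration

/-! ### Semisimplicity, nilpotent elements and extension of scalars. -/

section Semisimple

open scoped Pointwise

/-! The Frame number is, up to sign, the square of the determinant of a matrix that can be chosen
integral at any given prime, and whose reduction tells whether the algebra is semisimple.

The trace form of the standard module satisfies `tr (A(R) A(S)) = |R|` if `S` is the transpose of
`R`, and `0` otherwise. Hence it makes `W^ℂ` semisimple, and its Gram determinant is `± ∏ |R|`
(`det_gram`). Let `Q` be the square matrix of all entries of the irreducible representations at the
basis relations. Since the standard character is `∑ m_j χ_j`, the Gram matrix is also `Qᵀ diag(m)
Q'`, with `Q'` a row permutation of `Q`. Comparing determinants gives Frame number `= ± (det Q)²`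
(`exists_frameNumber_eq_det_sq`).

Given a prime `p`, take a valuation ring `O` of `ℂ` in which `p` is not a unit. Finitely generated
torsion-free `O`-modules are free, so the representations can be conjugated to be integral over `O`
(`exists_integral_algEquiv`). Then `Q` has entries in `O`, and letting `p` vary shows that the
rational Frame number is an integer.

Reducing modulo the maximal ideal gives a map from `W^κ` to a product of matrix algebras of the same
dimension. By Cayley–Hamilton its kernel is nil (`isNilpotent_of_scalarExtension_eq_zero`). So if
`W^κ` is semisimple the map is bijective; the converse is clear. Bijectivity means that `det Q` is a
unit of `O`, that is, `p` does not divide the Frame number. Comparison through the prime field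
replaces `κ` by any field of characteristic `p`. -/

theorem IsSemisimpleRing.eq_zero_of_forall_isNilpotent_mul {A : Type*} [Ring A]
    [IsSemisimpleRing A] {x : A} (hx : ∀ a, IsNilpotent (a * x)) : x = 0 := by
  have h : x ∈ Ring.jacobson A := by
    rw [← Ideal.jacobson_bot, Ideal.mem_jacobson_iff]
    intro y
    obtain ⟨z, hz⟩ := (hx y).isUnit_one_add.exists_left_inv
    refine ⟨z, ?_⟩
    rw [Ideal.mem_bot, ← hz]
    noncomm_ring
  rw [IsArtinianRing.isSemisimpleRing_iff_jacobson.mp ‹_›] at h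
  exact h

/-- The radical of an Artinian ring is a nilpotent ideal, so all left multiples of its elements are
nilpotent. -/
theorem IsArtinianRing.isSemisimpleRing_of_forall_isNilpotent_mul {A : Type*} [Ring A]
    [IsArtinianRing A] (h : ∀ x : A, (∀ a, IsNilpotent (a * x)) → x = 0) :
    IsSemisimpleRing A := by
  rw [IsArtinianRing.isSemisimpleRing_iff_jacobson, eq_bot_iff]
  intro x hx
  obtain ⟨n, hn⟩ := IsArtinianRing.isNilpotent_jacobson_bot (R := A)
  refine h x fun a => ⟨n, ?_⟩
  rw [Ideal.jacobson_bot] at hn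
  have : (a * x) ^ n ∈ Ring.jacobson A ^ n := Ideal.pow_mem_pow (Ideal.mul_mem_left _ a hx) n
  rw [hn] at this
  exact this

/-- Semisimplicity descends along field extensions. -/
theorem IsSemisimpleRing.of_tensorProduct (F k A : Type*) [Field F] [Field k] [Algebra F k]
    [Ring A] [Algebra F A] [FiniteDimensional F A] [IsSemisimpleRing (k ⊗[F] A)] :
    IsSemisimpleRing A := by
  have := IsArtinianRing.of_finite F A
  rw [IsArtinianRing.isSemisimpleRing_iff_jacobson, eq_bot_iff]
  intro x hx
  obtain ⟨n, hn⟩ := IsArtinianRing.isNilpotent_jacobson_bot (R := A)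
  rw [Ideal.jacobson_bot] at hn
  set ι : A →ₐ[F] k ⊗[F] A := Algebra.TensorProduct.includeRight with hι
  have hinj : Function.Injective ι := Algebra.TensorProduct.includeRight_injective
    (algebraMap F k).injective
  have key : ι x = 0 := by
    refine IsSemisimpleRing.eq_zero_of_forall_isNilpotent_mul fun b => ⟨n, ?_⟩
    -- The scalar extension of the radical is closed under left multiplication and its `n`-th power
    -- is still zero.
    set S : Submodule k (k ⊗[F] A) := Submodule.span k (ι '' (Ring.jacobson A : Set A)) with hS
    have hb : b * ι x ∈ S := by
      induction b using TensorProduct.induction_on with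
      | zero => simp
      | add a b ha hb => rw [add_mul]; exact S.add_mem ha hb
      | tmul c a =>
        have : c ⊗ₜ[F] a * ι x = c • ι (a * x) := by
          simp [hι, Algebra.TensorProduct.tmul_mul_tmul, TensorProduct.smul_tmul']
        rw [this]
        exact S.smul_mem _ (Submodule.subset_span ⟨_, Ideal.mul_mem_left _ a hx, rfl⟩)
    have hSn : S ^ n = ⊥ := by
      rw [hS, Submodule.span_pow, Submodule.span_eq_bot]
      have : ∀ m : ℕ, ∀ y ∈ (ι '' (Ring.jacobson A : Set A)) ^ m,
          y ∈ ι '' ((Ring.jacobson A ^ m : Ideal A) : Set A) := by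
        intro m
        induction m with
        | zero =>
          intro y hy
          rw [pow_zero, Set.mem_one] at hy
          exact ⟨1, by simp [Submodule.pow_zero], by simp [hy]⟩
        | succ m ih =>
          intro y hy
          rw [pow_succ] at hy
          obtain ⟨u, hu, _, ⟨v, hv, rfl⟩, rfl⟩ := hy
          obtain ⟨u, hu', rfl⟩ := ih u hu
          exact ⟨u * v, by rw [Submodule.pow_succ]; exact Ideal.mul_mem_mul hu' hv, map_mul _ _ _⟩
      intro y hy
      obtain ⟨u, hu, rfl⟩ := this n y hy
      rw [hn] at hu
      rw [show u = 0 from hu, map_zero]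
    have := Submodule.pow_mem_pow S hb n
    rw [hSn] at this
    exact this
  exact hinj (by rw [key, map_zero])

/-- A finite extension of a perfect field is separable, so its base change is reduced; a reduced
commutative Artinian ring is semisimple. -/
theorem IsSemisimpleRing.tensorProduct_of_field (F k L : Type*) [Field F] [PerfectField F]
    [Field k] [Algebra F k] [Field L] [Algebra F L] [FiniteDimensional F L] :
    IsSemisimpleRing (k ⊗[F] L) := by
  have : Algebra.FormallyUnramified F L := .of_isSeparable F L
  have : Module.Finite k (k ⊗[F] L) := inferInstance
  have := Algebra.FormallyUnramified.isReduced_of_field k (k ⊗[F] L)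
  have := IsArtinianRing.of_finite k (k ⊗[F] L)
  exact IsArtinianRing.isSemisimpleRing_of_isReduced _

/-- A semisimple algebra over a finite field remains semisimple under field extensions. -/
theorem IsSemisimpleRing.tensorProduct_of_finite (F k A : Type*) [Field F] [Finite F] [Field k]
    [Algebra F k] [Ring A] [Algebra F A] [FiniteDimensional F A] [IsSemisimpleRing A] :
    IsSemisimpleRing (k ⊗[F] A) := by
  obtain ⟨n, D, d, _, _, _, -, ⟨e⟩⟩ :=
    IsSemisimpleRing.exists_algEquiv_pi_matrix_divisionRing_finite F A
  have key : ∀ i, IsSemisimpleRing (k ⊗[F] Matrix (Fin (d i)) (Fin (d i)) (D i)) := by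
    intro i
    have : Finite (D i) := Module.finite_of_finite F
    -- Finiteness of `F` makes the division algebra commutative, which reduces the claim to field
    -- extensions.
    let _ : Field (D i) := littleWedderburn (D i)
    have := IsSemisimpleRing.tensorProduct_of_field F k (D i)
    let e₁ : k ⊗[F] Matrix (Fin (d i)) (Fin (d i)) (D i) ≃ₐ[F]
        Matrix (Fin (d i)) (Fin (d i)) (k ⊗[F] D i) :=
      (Algebra.TensorProduct.congr AlgEquiv.refl (matrixEquivTensor (Fin (d i)) F (D i))).trans
        ((Algebra.TensorProduct.assoc F F F k (D i) _).symm.trans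
          (matrixEquivTensor (Fin (d i)) F (k ⊗[F] D i)).symm)
    exact e₁.symm.toRingEquiv.isSemisimpleRing
  let e₂ : k ⊗[F] A ≃ₐ[F] ∀ i, k ⊗[F] Matrix (Fin (d i)) (Fin (d i)) (D i) :=
    (Algebra.TensorProduct.congr AlgEquiv.refl e).trans
      (Algebra.TensorProduct.piRight F F k _)
  exact e₂.symm.toRingEquiv.isSemisimpleRing

end Semisimple

/-! ### Integral forms of representations over valuation rings. -/

section Lattice

/-- A finitely generated torsion-free module over a valuation ring is free. -/
theorem ValuationRing.free_of_isTorsionFree (O M : Type*) [CommRing O] [IsDomain O]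
    [ValuationRing O] [AddCommGroup M] [Module O M] [Module.Finite O M] [Module.IsTorsionFree O M] :
    Module.Free O M := by
  have : Module.Flat O M := by
    rw [Module.Flat.flat_iff_torsion_eq_bot_of_isBezout,
      ← Submodule.isTorsionFree_iff_torsion_eq_bot]
    infer_instance
  exact Module.free_of_flat_of_isLocalRing

/-- A matrix representation over the fraction field of a valuation ring `O`, of a ring that is
finitely generated as an abelian group, is conjugate to a representation over `O`. -/
theorem ValuationRing.exists_conj_integral (O : Type*) {K W : Type*} [CommRing O] [IsDomain O]
    [ValuationRing O] [Field K] [Algebra O K] [IsFractionRing O K] [Ring W] [Module.Finite ℤ W]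
    {d : ℕ} (φ : W →+* Matrix (Fin d) (Fin d) K) :
    ∃ (g : (Matrix (Fin d) (Fin d) K)ˣ) (ψ : W →+* Matrix (Fin d) (Fin d) O),
      ∀ w, (ψ w).map (algebraMap O K) = g * φ w * (g⁻¹ : (Matrix (Fin d) (Fin d) K)ˣ) := by
  classical
  obtain ⟨s, hs⟩ := Module.Finite.fg_top (R := ℤ) (M := W)
  -- The `O`-span of the `W`-translates of the standard basis: finitely generated because `W` is so
  -- over `ℤ`. An `O`-basis of it provides the conjugating matrix.
  set L : Submodule O (Fin d → K) :=
    Submodule.span O ((fun x : W × Fin d => φ x.1 *ᵥ Pi.single x.2 1) '' ((s : Set W) ×ˢ Set.univ))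
    with hL
  have hmem : ∀ w j, φ w *ᵥ Pi.single j 1 ∈ L := by
    intro w j
    have hw : w ∈ Submodule.span ℤ (s : Set W) := by rw [hs]; trivial
    induction hw using Submodule.span_induction with
    | mem x hx => exact Submodule.subset_span ⟨(x, j), ⟨hx, trivial⟩, rfl⟩
    | zero => rw [map_zero, Matrix.zero_mulVec]; exact L.zero_mem
    | add x y _ _ hx hy => rw [map_add, Matrix.add_mulVec]; exact L.add_mem hx hy
    | smul a x _ hx => rw [map_zsmul, Matrix.smul_mulVec]; exact zsmul_mem hx a
  have hstab : ∀ w, ∀ x ∈ L, φ w *ᵥ x ∈ L := by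
    intro w x hx
    induction hx using Submodule.span_induction with
    | mem x hx =>
      obtain ⟨⟨v, j⟩, -, rfl⟩ := hx
      dsimp only
      rw [Matrix.mulVec_mulVec, ← map_mul]
      exact hmem _ _
    | zero => simp
    | add x y _ _ hx hy => rw [Matrix.mulVec_add]; exact L.add_mem hx hy
    | smul a x _ hx => rw [Matrix.mulVec_smul]; exact L.smul_mem a hx
  have : Submodule.IsLattice K L := by
    refine ⟨Submodule.fg_span ((s.finite_toSet.prod Set.finite_univ).image _), ?_⟩
    rw [eq_top_iff, ← (Pi.basisFun K (Fin d)).span_eq, Submodule.span_le]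
    rintro _ ⟨j, rfl⟩
    refine Submodule.subset_span ?_
    simpa only [map_one, Matrix.one_mulVec, Pi.basisFun_apply, SetLike.mem_coe] using hmem 1 j
  have : Module.IsTorsionFree O K := inferInstance
  have : Module.IsTorsionFree O (Fin d → K) := inferInstance
  have : Module.IsTorsionFree O L := inferInstance
  have : Module.Finite O L := Submodule.IsLattice.finite K L
  have : Module.Free O L := ValuationRing.free_of_isTorsionFree O L
  have hcard : Fintype.card (Module.Free.ChooseBasisIndex O L) = Fintype.card (Fin d) := by
    rw [← Module.finrank_eq_card_basis ((Module.Free.chooseBasis O L).extendOfIsLattice K)]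
    simp
  let b : Module.Basis (Fin d) O L :=
    (Module.Free.chooseBasis O L).reindex (Fintype.equivOfCardEq hcard)
  let bK : Module.Basis (Fin d) K (Fin d → K) := b.extendOfIsLattice K
  have hrepr : ∀ x : L, ∀ i, bK.repr (x : Fin d → K) i = algebraMap O K (b.repr x i) := by
    intro x i
    have hx : (x : Fin d → K) = ∑ j, algebraMap O K (b.repr x j) • bK j := by
      have := congrArg (fun y : L => (y : Fin d → K)) (b.sum_repr x)
      rw [← this]
      simp only [bK, AddSubmonoidClass.coe_finsetSum, Submodule.coe_smul_of_tower,
        algebraMap_smul, Module.Basis.extendOfIsLattice_apply]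
    rw [hx]
    simp only [map_sum, map_smul, Module.Basis.repr_self, Finsupp.coe_finsetSum,
      Finset.sum_apply, Finsupp.smul_apply, Finsupp.single_apply, smul_eq_mul]
    simp
  let e := Pi.basisFun K (Fin d)
  let g : (Matrix (Fin d) (Fin d) K)ˣ :=
    ⟨bK.toMatrix e, e.toMatrix bK, bK.toMatrix_mul_toMatrix_flip e, e.toMatrix_mul_toMatrix_flip bK⟩
  have hg : ∀ w, ∃ N : Matrix (Fin d) (Fin d) O,
      N.map (algebraMap O K) = g * φ w * (g⁻¹ : (Matrix (Fin d) (Fin d) K)ˣ) := by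
    intro w
    refine ⟨Matrix.of fun i j => b.repr ⟨φ w *ᵥ (b j : Fin d → K), hstab w _ (b j).2⟩ i, ?_⟩
    have h1 : (g : Matrix (Fin d) (Fin d) K) * φ w * (g⁻¹ : (Matrix (Fin d) (Fin d) K)ˣ) =
        LinearMap.toMatrix bK bK (Matrix.toLin' (φ w)) := by
      rw [← basis_toMatrix_mul_linearMap_toMatrix_mul_basis_toMatrix bK e bK e]
      congr 2
      exact (LinearMap.toMatrix'_toLin' _).symm
    rw [h1]
    ext i j
    rw [LinearMap.toMatrix_apply, Matrix.map_apply, Matrix.of_apply, ← hrepr]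
    simp [bK]
  choose ψ hψ using hg
  have hinj : Function.Injective fun N : Matrix (Fin d) (Fin d) O => N.map (algebraMap O K) :=
    Matrix.map_injective (IsFractionRing.injective O K)
  refine ⟨g, ⟨⟨⟨ψ, hinj ?_⟩, fun x y => hinj ?_⟩, hinj ?_, fun x y => hinj ?_⟩, hψ⟩
  · simp only [hψ, map_one, mul_one, Units.mul_inv]
    simp
  · simp only [Matrix.map_mul, hψ, map_mul]
    simp only [mul_assoc, Units.inv_mul_cancel_left]
  · simp [hψ]
  · simp only [Matrix.map_add _ (map_add (algebraMap O K)), hψ, map_add, mul_add, add_mul]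

end Lattice

/-! ### Simple modules over a product of matrix algebras. -/

section PiMatrix

variable {K B : Type*} [Field K] [Ring B] [Algebra K B] {n : ℕ} {d : Fin n → ℕ}

/-- The module of column vectors over the `j`-th factor of a product of matrix algebras. -/
def ColumnModule (_ : B ≃ₐ[K] Π j, Matrix (Fin (d j)) (Fin (d j)) K) (j : Fin n) : Type _ :=
  Fin (d j) → K

variable (e : B ≃ₐ[K] Π j, Matrix (Fin (d j)) (Fin (d j)) K)

namespace ColumnModule

instance (j : Fin n) : AddCommGroup (ColumnModule e j) :=
  inferInstanceAs (AddCommGroup (Fin (d j) → K))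

instance (j : Fin n) : Module K (ColumnModule e j) :=
  inferInstanceAs (Module K (Fin (d j) → K))

instance (j : Fin n) : Module.Finite K (ColumnModule e j) :=
  inferInstanceAs (Module.Finite K (Fin (d j) → K))

instance (j : Fin n) : Module B (ColumnModule e j) where
  smul b v := e b j *ᵥ (show Fin (d j) → K from v)
  one_smul v := by
    change e 1 j *ᵥ (show Fin (d j) → K from v) = v
    rw [map_one, Pi.one_apply]; exact Matrix.one_mulVec _
  mul_smul a b v := by
    change e (a * b) j *ᵥ (show Fin (d j) → K from v) = e a j *ᵥ (e b j *ᵥ _)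
    rw [map_mul, Pi.mul_apply, Matrix.mulVec_mulVec]
  smul_zero a := Matrix.mulVec_zero _
  smul_add a x y := Matrix.mulVec_add _ _ _
  add_smul a b v := by
    change e (a + b) j *ᵥ (show Fin (d j) → K from v) = e a j *ᵥ _ + e b j *ᵥ _
    rw [map_add, Pi.add_apply, Matrix.add_mulVec]
  zero_smul v := by
    change e 0 j *ᵥ (show Fin (d j) → K from v) = 0
    rw [map_zero, Pi.zero_apply, Matrix.zero_mulVec]

variable {e}

theorem smul_def {j : Fin n} (b : B) (v : ColumnModule e j) :
    b • v = (e b j *ᵥ (show Fin (d j) → K from v) : Fin (d j) → K) := rfl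

instance (j : Fin n) : IsScalarTower K B (ColumnModule e j) where
  smul_assoc a b v := by
    change e (a • b) j *ᵥ (show Fin (d j) → K from v) = a • (e b j *ᵥ _)
    rw [map_smul, Pi.smul_apply, Matrix.smul_mulVec]

theorem finrank_eq (j : Fin n) : Module.finrank K (ColumnModule e j) = d j := by
  change Module.finrank K (Fin (d j) → K) = d j
  simp

instance [∀ j, NeZero (d j)] (j : Fin n) : IsSimpleModule B (ColumnModule e j) := by
  rw [isSimpleModule_iff_toSpanSingleton_surjective]
  refine ⟨inferInstanceAs (Nontrivial (Fin (d j) → K)), fun v hv w => ?_⟩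
  obtain ⟨a, ha⟩ : ∃ a, (show Fin (d j) → K from v) a ≠ 0 := Function.ne_iff.mp hv
  -- A rank-one matrix carrying `v` to `w`, built from a nonzero coordinate `a` of `v`.
  refine ⟨e.symm (Pi.single j (Matrix.vecMulVec (show Fin (d j) → K from w)
    (Pi.single a ((show Fin (d j) → K from v) a)⁻¹))), ?_⟩
  rw [LinearMap.toSpanSingleton_apply, smul_def, AlgEquiv.apply_symm_apply, Pi.single_eq_same,
    Matrix.vecMulVec_mulVec, single_dotProduct, inv_mul_cancel₀ ha,
    MulOpposite.op_one]
  exact one_smul _ (show Fin (d j) → K from w)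

end ColumnModule

/-- The central idempotent of a product of matrix algebras belonging to the `j`-th factor. -/
noncomputable def factorIdempotent (j : Fin n) : B := e.symm (Pi.single j 1)

theorem factorIdempotent_mul_comm (j : Fin n) (b : B) :
    factorIdempotent e j * b = b * factorIdempotent e j := by
  apply e.injective
  rw [map_mul, map_mul, factorIdempotent, AlgEquiv.apply_symm_apply]
  ext i : 1
  obtain rfl | h := eq_or_ne i j
  · simp
  · simp [h]

theorem factorIdempotent_mul_self (j : Fin n) :
    factorIdempotent e j * factorIdempotent e j = factorIdempotent e j := by
  rw [factorIdempotent, ← map_mul, ← Pi.single_mul, one_mul]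

theorem sum_factorIdempotent : ∑ j, factorIdempotent e j = 1 := by
  simp only [factorIdempotent]
  have h : ∑ j, Pi.single j 1 = (1 : Π j, Matrix (Fin (d j)) (Fin (d j)) K) :=
    Finset.univ_sum_single (1 : Π j, Matrix (Fin (d j)) (Fin (d j)) K)
  rw [← map_sum, h, map_one]

theorem factorIdempotent_smul_columnModule (j : Fin n) (v : ColumnModule e j) :
    factorIdempotent e j • v = v := by
  rw [ColumnModule.smul_def, factorIdempotent, AlgEquiv.apply_symm_apply, Pi.single_eq_same]
  exact Matrix.one_mulVec _

theorem factorIdempotent_smul_columnModule_of_ne {i j : Fin n} (h : i ≠ j)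
    (v : ColumnModule e i) : factorIdempotent e j • v = 0 := by
  rw [ColumnModule.smul_def, factorIdempotent, AlgEquiv.apply_symm_apply,
    Pi.single_eq_of_ne h, Matrix.zero_mulVec]
  rfl

theorem factorIdempotent_smul_of_linearEquiv {S : Type*} [AddCommGroup S] [Module B S] {j : Fin n}
    (f : ColumnModule e j ≃ₗ[B] S) (s : S) : factorIdempotent e j • s = s := by
  rw [← f.apply_symm_apply s, ← map_smul, factorIdempotent_smul_columnModule]

variable [∀ j, NeZero (d j)]

/-- The idempotent of the `j`-th factor acts as `1` on the `j`-th column module and as `0` on the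
others. -/
theorem ColumnModule.eq_of_linearEquiv {i j : Fin n}
    (f : ColumnModule e i ≃ₗ[B] ColumnModule e j) : i = j := by
  by_contra h
  have := IsSimpleModule.nontrivial B (ColumnModule e j)
  obtain ⟨v, hv⟩ := exists_ne (0 : ColumnModule e j)
  apply hv
  rw [← factorIdempotent_smul_of_linearEquiv e f v,
    factorIdempotent_smul_columnModule_of_ne e (Ne.symm h)]

/-- The homomorphism from a column module determined by the image of the first basis vector. -/
noncomputable def ColumnModule.lift {N : Type*} [AddCommGroup N] [Module B N] (j : Fin n) (s : N) :
    ColumnModule e j →ₗ[B] N where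
  toFun v := e.symm (Pi.single j
    (Matrix.vecMulVec (show Fin (d j) → K from v) (Pi.single 0 1))) • s
  map_add' v w := by
    rw [← add_smul, ← map_add, ← Pi.single_add, ← Matrix.add_vecMulVec]
    rfl
  map_smul' b v := by
    rw [RingHom.id_apply, ← mul_smul]
    congr 1
    apply e.injective
    rw [map_mul, AlgEquiv.apply_symm_apply, AlgEquiv.apply_symm_apply]
    ext i : 1
    obtain rfl | h := eq_or_ne i j
    · rw [Pi.mul_apply, Pi.single_eq_same, Pi.single_eq_same, Matrix.mul_vecMulVec]
      rfl
    · simp [h]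

theorem ColumnModule.lift_apply {N : Type*} [AddCommGroup N] [Module B N] (j : Fin n) (s : N)
    (v : ColumnModule e j) : ColumnModule.lift e j s v = e.symm (Pi.single j
      (Matrix.vecMulVec (show Fin (d j) → K from v) (Pi.single 0 1))) • s := rfl

/-- The idempotent is a sum of products `E_{a0} E_{0a}`, one of which does not kill `s`. The map
sending the first basis vector to `E_{0a} s` is then nonzero, and Schur's lemma applies. -/
theorem ColumnModule.nonempty_linearEquiv {S : Type*} [AddCommGroup S] [Module B S]
    [IsSimpleModule B S] {j : Fin n} {s : S} (hs : factorIdempotent e j • s ≠ 0) :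
    Nonempty (ColumnModule e j ≃ₗ[B] S) := by
  have h1 : factorIdempotent e j = ∑ a, e.symm (Pi.single j (Matrix.single a 0 1)) *
      e.symm (Pi.single j (Matrix.single 0 a 1)) := by
    simp only [← map_mul, ← Pi.single_mul, Matrix.single_mul_single_same, mul_one]
    rw [← map_sum, factorIdempotent]
    congr 1
    rw [← Matrix.sum_single_one]
    exact map_sum (AddMonoidHom.single (fun j => Matrix (Fin (d j)) (Fin (d j)) K) j) _ _
  rw [h1, Finset.sum_smul] at hs
  obtain ⟨a, -, ha⟩ := Finset.exists_ne_zero_of_sum_ne_zero hs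
  rw [mul_smul] at ha
  have hne : ColumnModule.lift e j (e.symm (Pi.single j (Matrix.single 0 a 1)) • s) ≠ 0 := by
    intro h
    apply ha
    have := LinearMap.congr_fun h (show ColumnModule e j from (Pi.single a 1 : Fin (d j) → K))
    rw [LinearMap.zero_apply, ColumnModule.lift_apply] at this
    rw [← this, Matrix.single_eq_single_vecMulVec_single]
  exact ⟨LinearEquiv.ofBijective _ (LinearMap.bijective_of_ne_zero hne)⟩

theorem ColumnModule.exists_linearEquiv (S : Type*) [AddCommGroup S] [Module B S]
    [IsSimpleModule B S] : ∃ j, Nonempty (ColumnModule e j ≃ₗ[B] S) := by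
  have := IsSimpleModule.nontrivial B S
  obtain ⟨s, hs⟩ := exists_ne (0 : S)
  rw [← one_smul B s, ← sum_factorIdempotent e, Finset.sum_smul] at hs
  obtain ⟨j, -, hj⟩ := Finset.exists_ne_zero_of_sum_ne_zero hs
  exact ⟨j, ColumnModule.nonempty_linearEquiv e hj⟩

instance Irr.isSimpleModule_rep {B : Type*} [Ring B] (i : Irr B) : IsSimpleModule B i.Rep :=
  isSimpleModule_iff_isCoatom.mpr (Quotient.out i).2

/-- The factor of a product of matrix algebras belonging to a simple module. -/
noncomputable def Irr.factor (i : Irr B) : Fin n := (ColumnModule.exists_linearEquiv e i.Rep).choose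

/-- A simple module is the column module of its factor. -/
noncomputable def Irr.columnEquiv (i : Irr B) : ColumnModule e (i.factor e) ≃ₗ[B] i.Rep :=
  (ColumnModule.exists_linearEquiv e i.Rep).choose_spec.some

/-- Lets isomorphism classes of simple modules be indexed by the matrix factors; in particular there
are finitely many. -/
theorem Irr.factor_bijective : Function.Bijective (Irr.factor e) := by
  constructor
  · intro i i' h
    have f := i.columnEquiv e
    rw [h] at f
    rw [← Quotient.out_eq i, ← Quotient.out_eq i']
    exact Quotient.sound ⟨f.symm.trans (i'.columnEquiv e)⟩
  · intro j
    obtain ⟨I, hI, ⟨f⟩⟩ := isSimpleModule_iff_quot_maximal.mp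
      (inferInstance : IsSimpleModule B (ColumnModule e j))
    let i : Irr B := Quotient.mk (simpleModuleSetoid B) ⟨I, hI.out⟩
    have h : Nonempty (i.Rep ≃ₗ[B] B ⧸ I) := Quotient.mk_out (s := simpleModuleSetoid B) ⟨I, hI.out⟩
    exact ⟨i, ColumnModule.eq_of_linearEquiv e ((i.columnEquiv e).trans (h.some.trans f.symm))⟩

theorem Irr.finrank_rep (i : Irr B) : Module.finrank K i.Rep = d (i.factor e) := by
  rw [← ((i.columnEquiv e).restrictScalars K).finrank_eq, ColumnModule.finrank_eq]

end PiMatrix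

/-! ### Multiplicities and dimensions of isotypic components. -/

section Multiplicity

/-- By finite dimensionality the component is a finite power of `i.Rep`, so `toNat` in the
multiplicity does not meet an infinite length. -/
theorem Irr.multiplicity_mul_finrank {K B : Type*} [Field K] [Ring B] [Algebra K B]
    (i : Irr B) [Module.Finite K i.Rep] (N : Type*) [AddCommGroup N] [Module B N] [Module K N]
    [IsScalarTower K B N] [Module.Finite K N] :
    Module.finrank K (isotypicComponent B N i.Rep) =
      i.multiplicity N * Module.finrank K i.Rep := by
  set P := isotypicComponent B N i.Rep with hP
  have : Module.Finite K P := inferInstanceAs (Module.Finite K (P.restrictScalars K))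
  have : Module.Finite B P := Module.Finite.of_restrictScalars_finite K B P
  obtain ⟨m, ⟨f⟩⟩ := (IsIsotypicOfType.isotypicComponent B N i.Rep).linearEquiv_fun
  have hm : i.multiplicity N = m := by
    rw [Irr.multiplicity, f.length_eq, Module.length_pi]
    simp
  rw [hm, (f.restrictScalars K).finrank_eq, Module.finrank_pi_fintype]
  simp

end Multiplicity

/-! ### Characters as combinations of matrix traces. -/

section Trace

/-- A trace function on a matrix algebra is a multiple of the trace. -/
theorem Matrix.eq_mul_trace_of_mul_comm {K m : Type*} [Field K] [Fintype m] [DecidableEq m]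
    (τ : Matrix m m K →ₗ[K] K) (hτ : ∀ M N, τ (M * N) = τ (N * M)) (a : m) (M : Matrix m m K) :
    τ M = τ (Matrix.single a a 1) * M.trace := by
  have hd : ∀ b, τ (Matrix.single b b 1) = τ (Matrix.single a a 1) := by
    intro b
    -- `E_{ba} E_{ab} = E_{bb}` and `E_{ab} E_{ba} = E_{aa}`.
    have := hτ (Matrix.single b a 1) (Matrix.single a b 1)
    simpa using this
  have ho : ∀ b c, b ≠ c → τ (Matrix.single b c 1) = 0 := by
    intro b c h
    have := hτ (Matrix.single b b 1) (Matrix.single b c 1)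
    simpa [Matrix.single_mul_single_of_ne, h.symm] using this
  have hs : ∀ b c, τ (Matrix.single b c (M b c)) = if b = c then M b b * τ (Matrix.single a a 1)
      else 0 := by
    intro b c
    have : Matrix.single b c (M b c) = M b c • Matrix.single b c 1 := by simp
    rw [this, map_smul, smul_eq_mul]
    split_ifs with h
    · rw [← h, hd]
    · rw [ho b c h, mul_zero]
  conv_lhs => rw [Matrix.matrix_eq_sum_single M]
  simp only [map_sum, hs, Finset.sum_ite_eq, Finset.mem_univ, if_true, Matrix.trace,
    Matrix.diag_apply, Finset.mul_sum]
  exact Finset.sum_congr rfl fun _ _ => mul_comm _ _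

variable {K B : Type*} [Field K] [Ring B] [Algebra K B] {n : ℕ} {d : Fin n → ℕ}
  [∀ j, NeZero (d j)] (e : B ≃ₐ[K] Π j, Matrix (Fin (d j)) (Fin (d j)) K)
  (N : Type*) [AddCommGroup N] [Module B N]

/-- The idempotent is central, so its image is a submodule, and it fixes every simple submodule of
that image. With the next lemma, it is the projection onto the isotypic component. -/
theorem factorIdempotent_smul_mem_isotypicComponent [IsSemisimpleRing B] (i : Irr B) (x : N) :
    factorIdempotent e (i.factor e) • x ∈ isotypicComponent B N i.Rep := by
  let c : N →ₗ[B] N :=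
    { toFun := fun x => factorIdempotent e (i.factor e) • x
      map_add' := smul_add _
      map_smul' := fun b x => by
        rw [RingHom.id_apply, ← mul_smul, ← mul_smul, factorIdempotent_mul_comm] }
  have hle : LinearMap.range c ≤ isotypicComponent B N i.Rep := by
    rw [le_isotypicComponent_iff, isIsotypicOfType_submodule_iff]
    intro m hm _
    have := IsSimpleModule.nontrivial B m
    obtain ⟨s, hs⟩ := exists_ne (0 : m)
    have : factorIdempotent e (i.factor e) • s ≠ 0 := by
      obtain ⟨y, hy⟩ := hm s.2
      intro h
      apply hs
      ext
      have h' := congrArg Subtype.val h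
      rw [Submodule.coe_smul, ← hy] at h'
      change factorIdempotent e (i.factor e) • (factorIdempotent e (i.factor e) • y) = 0 at h'
      rw [← mul_smul, factorIdempotent_mul_self] at h'
      rw [← hy]
      exact h'
    exact ⟨(ColumnModule.nonempty_linearEquiv e this).some.symm.trans (i.columnEquiv e)⟩
  exact hle ⟨x, rfl⟩

theorem factorIdempotent_smul_of_mem_isotypicComponent (i : Irr B) {x : N}
    (hx : x ∈ isotypicComponent B N i.Rep) : factorIdempotent e (i.factor e) • x = x := by
  rw [isotypicComponent, sSup_eq_iSup] at hx
  induction hx using Submodule.iSup_induction' with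
  | zero => simp
  | add x y _ _ hx hy => rw [smul_add, hx, hy]
  | mem m x hx =>
    -- The supremum runs over all submodules; those outside the set contribute `⊥`.
    by_cases hm : m ∈ {m : Submodule B N | Nonempty (m ≃ₗ[B] i.Rep)}
    · rw [iSup_pos hm] at hx
      obtain ⟨f⟩ := hm
      exact congrArg Subtype.val
        (factorIdempotent_smul_of_linearEquiv e ((i.columnEquiv e).trans f.symm) ⟨x, hx⟩)
    · rw [iSup_neg hm, Submodule.mem_bot] at hx
      rw [hx, smul_zero]

/-- The index set is finite, so the `finprod` is a genuine product and not its default value `1`. -/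
theorem finprod_multiplicity_pow :
    ∏ᶠ i : Irr B, (i.multiplicity N : ℚ) ^ (Module.finrank K i.Rep) ^ 2 =
      ∏ j, (((Equiv.ofBijective _ (Irr.factor_bijective e)).symm j).multiplicity N : ℚ) ^
        (d j) ^ 2 := by
  rw [← finprod_eq_prod_of_fintype,
    ← finprod_comp_equiv (Equiv.ofBijective _ (Irr.factor_bijective e))]
  refine finprod_congr fun i => ?_
  rw [Equiv.symm_apply_apply, i.finrank_rep e]
  rfl

variable [Module K N] [IsScalarTower K B N] [Module.Finite K N]

theorem trace_factorIdempotent [IsSemisimpleRing B] (i : Irr B) :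
    LinearMap.trace K N (Algebra.lsmul K K N (factorIdempotent e (i.factor e))) =
      (i.multiplicity N * d (i.factor e) : ℕ) := by
  have : Module.Finite K i.Rep := Module.Finite.equiv ((i.columnEquiv e).restrictScalars K)
  rw [← i.finrank_rep e, ← i.multiplicity_mul_finrank]
  refine LinearMap.IsProj.trace (p := (isotypicComponent B N i.Rep).restrictScalars K)
    ⟨fun x => ?_, fun x hx => ?_⟩
  · exact factorIdempotent_smul_mem_isotypicComponent e N i x
  · exact factorIdempotent_smul_of_mem_isotypicComponent e N i hx

/-- The character of a module is the combination of the irreducible characters given by the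
multiplicities. -/
theorem trace_lsmul_eq_sum [CharZero K] [IsSemisimpleRing B] (b : B) :
    LinearMap.trace K N (Algebra.lsmul K K N b) =
      ∑ j, (((Equiv.ofBijective _ (Irr.factor_bijective e)).symm j).multiplicity N : K) *
        (e b j).trace := by
  have hb : b = ∑ j, e.symm (Pi.single j (e b j)) := by
    rw [← map_sum, Finset.univ_sum_single, AlgEquiv.symm_apply_apply]
  conv_lhs => rw [hb]
  rw [map_sum, map_sum]
  refine Finset.sum_congr rfl fun j _ => ?_
  set i := (Equiv.ofBijective _ (Irr.factor_bijective e)).symm j with hi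
  have hij : i.factor e = j := (Equiv.ofBijective _ (Irr.factor_bijective e)).apply_symm_apply j
  let τ : Matrix (Fin (d j)) (Fin (d j)) K →ₗ[K] K :=
    LinearMap.trace K N ∘ₗ (Algebra.lsmul K K N).toLinearMap ∘ₗ e.symm.toLinearMap ∘ₗ
      LinearMap.single K (fun j => Matrix (Fin (d j)) (Fin (d j)) K) j
  have hτ : ∀ M, τ M = LinearMap.trace K N (Algebra.lsmul K K N (e.symm (Pi.single j M))) :=
    fun M => rfl
  have hcomm : ∀ M M', τ (M * M') = τ (M' * M) := by
    intro M M'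
    simp only [hτ, Pi.single_mul, map_mul]
    exact LinearMap.trace_mul_comm K _ _
  have h1 : τ 1 = i.multiplicity N * d j := by
    have := trace_factorIdempotent e N i
    rw [hij] at this
    rw [hτ]
    exact_mod_cast this
  -- The factor of proportionality between `τ` and the trace is found by evaluating both at `1` and
  -- cancelling `d j`, nonzero in characteristic zero.
  have hsingle := Matrix.eq_mul_trace_of_mul_comm τ hcomm 0
  have h2 := hsingle 1
  rw [h1, Matrix.trace_one, Fintype.card_fin] at h2
  have h3 := mul_right_cancel₀ (Nat.cast_ne_zero.mpr (NeZero.ne (d j))) h2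
  rw [← hτ, hsingle, ← h3]

end Trace

/-! ### The adjacency basis and the trace form of the standard module. -/

namespace CoherentConfiguration

variable {V : Type*} [Fintype V] [DecidableEq V] (C : CoherentConfiguration V)

theorem eq_of_mem_of_mem {R S : Finset (V × V)} (hR : R ∈ C.rels) (hS : S ∈ C.rels) {x : V × V}
    (hxR : x ∈ R) (hxS : x ∈ S) : R = S :=
  (C.existsUnique_mem x).unique ⟨hR, hxR⟩ ⟨hS, hxS⟩

/-- The adjacency matrix of a basis relation, as an element of the adjacency ring. -/
def adjacency (R : C.rels) : C.adjacencyRing :=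
  ⟨adjacencyMatrix R.1, Submodule.subset_span ⟨R.1, R.2, rfl⟩⟩

theorem linearIndependent_adjacencyMatrix :
    LinearIndependent ℤ fun R : C.rels => adjacencyMatrix R.1 := by
  rw [Fintype.linearIndependent_iff]
  intro c hc R
  obtain ⟨⟨u, v⟩, huv⟩ := C.nonempty_of_mem R.1 R.2
  have := congrFun (congrFun hc u) v
  rw [Matrix.sum_apply, Finset.sum_eq_single R] at this
  · simpa [adjacencyMatrix, huv] using this
  · intro S _ hS
    have : (u, v) ∉ S.1 := fun h => hS (Subtype.ext (C.eq_of_mem_of_mem S.2 R.2 h huv))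
    simp [adjacencyMatrix, this]
  · simp

/-- The adjacency matrices of the basis relations form a basis of the adjacency ring. -/
noncomputable def adjacencyBasis : Module.Basis C.rels ℤ C.adjacencyRing :=
  Module.Basis.mk (v := C.adjacency)
    (LinearIndependent.of_comp C.adjacencyRing.val.toLinearMap
      C.linearIndependent_adjacencyMatrix)
    (by
      rintro ⟨x, hx⟩ -
      have hx' : x ∈ Submodule.span ℤ (adjacencyMatrix '' (C.rels : Set (Finset (V × V)))) := hx
      have hmap : (Submodule.span ℤ (Set.range C.adjacency)).map C.adjacencyRing.val.toLinearMap =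
          Submodule.span ℤ (adjacencyMatrix '' (C.rels : Set (Finset (V × V)))) := by
        rw [Submodule.map_span, ← Set.range_comp]
        congr 1
        ext y
        simp [adjacency]
      rw [← hmap] at hx'
      obtain ⟨y, hy, rfl⟩ := hx'
      exact hy)

@[simp]
theorem adjacencyBasis_apply (R : C.rels) : C.adjacencyBasis R = C.adjacency R := by
  simp [adjacencyBasis]

instance : Module.Free ℤ C.adjacencyRing := .of_basis C.adjacencyBasis

instance : Module.Finite ℤ C.adjacencyRing := .of_basis C.adjacencyBasis

/-- Transposition of basis relations. -/
def transposeRel : Equiv.Perm C.rels :=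
  Function.Involutive.toPerm (fun R => ⟨R.1.image Prod.swap, C.transpose_mem R.1 R.2⟩)
    fun R => Subtype.ext (by simp [Finset.image_image])

theorem mem_transposeRel (R : C.rels) (u v : V) :
    (u, v) ∈ (C.transposeRel R).1 ↔ (v, u) ∈ R.1 := by
  change (u, v) ∈ R.1.image Prod.swap ↔ _
  simp

theorem transposeRel_transposeRel (R : C.rels) : C.transposeRel (C.transposeRel R) = R :=
  C.transposeRel.symm_apply_apply R

/-- The trace counts the pairs in `R` whose swap lies in `S`, and distinct basis relations are
disjoint. -/
theorem trace_adjacency_mul (R S : C.rels) :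
    ((C.adjacency R * C.adjacency S : C.adjacencyRing) : Matrix V V ℤ).trace =
      if S = C.transposeRel R then (R.1.card : ℤ) else 0 := by
  have h : ((C.adjacency R * C.adjacency S : C.adjacencyRing) : Matrix V V ℤ).trace =
      ∑ x : V × V, if x ∈ R.1 ∧ x.swap ∈ S.1 then (1 : ℤ) else 0 := by
    rw [Fintype.sum_prod_type]
    simp only [MulMemClass.coe_mul, Matrix.trace, Matrix.diag_apply, Matrix.mul_apply]
    refine Finset.sum_congr rfl fun u _ => Finset.sum_congr rfl fun v _ => ?_
    by_cases h1 : (u, v) ∈ R.1 <;> by_cases h2 : (v, u) ∈ S.1 <;>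
      simp [adjacency, adjacencyMatrix, h1, h2]
  rw [h]
  split_ifs with hS
  · subst hS
    have : ∀ x : V × V, (x ∈ R.1 ∧ x.swap ∈ (C.transposeRel R).1) ↔ x ∈ R.1 := by
      rintro ⟨u, v⟩
      rw [Prod.swap_prod_mk, mem_transposeRel, and_self]
    simp [this]
  · refine Finset.sum_eq_zero fun x _ => if_neg fun ⟨h1, h2⟩ => hS (Subtype.ext ?_)
    obtain ⟨u, v⟩ := x
    exact C.eq_of_mem_of_mem S.2 (C.transposeRel R).2 h2 ((C.mem_transposeRel R v u).2 h1)

/-- The adjacency matrices of the basis relations form a basis of the adjacency algebra. -/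
noncomputable def algebraBasis (k : Type*) [Field k] :
    Module.Basis C.rels k (C.adjacencyAlgebra k) :=
  Algebra.TensorProduct.basis k C.adjacencyBasis

@[simp]
theorem algebraBasis_apply (k : Type*) [Field k] (R : C.rels) :
    C.algebraBasis k R = 1 ⊗ₜ C.adjacency R := by
  simp [algebraBasis]

instance (k : Type*) [Field k] : Module.Finite k (C.adjacencyAlgebra k) :=
  .of_basis (C.algebraBasis k)

theorem toMatrix_tmul (k : Type*) [Field k] (c : k) (w : C.adjacencyRing) :
    C.toMatrix k (c ⊗ₜ w) = c • (w : Matrix V V ℤ).map (Int.castRingHom k) := by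
  rw [toMatrix, Algebra.TensorProduct.lift_tmul, Algebra.ofId_apply, ← Algebra.smul_def]
  rfl

theorem trace_toMatrix_algebraBasis_mul (k : Type*) [Field k] (R S : C.rels) :
    (C.toMatrix k (C.algebraBasis k R * C.algebraBasis k S)).trace =
      if S = C.transposeRel R then (R.1.card : k) else 0 := by
  rw [algebraBasis_apply, algebraBasis_apply, Algebra.TensorProduct.tmul_mul_tmul, one_mul,
    toMatrix_tmul, one_smul]
  have := congrArg (Int.castRingHom k) (C.trace_adjacency_mul R S)
  rw [AddMonoidHom.map_trace] at this
  rw [this]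
  split_ifs <;> simp

theorem card_ne_zero (k : Type*) [Field k] [CharZero k] (R : C.rels) : (R.1.card : k) ≠ 0 :=
  Nat.cast_ne_zero.mpr (C.nonempty_of_mem R.1 R.2).card_ne_zero

/-- In characteristic zero the adjacency algebra is semisimple. -/
instance isSemisimpleRing_adjacencyAlgebra (k : Type*) [Field k] [CharZero k] :
    IsSemisimpleRing (C.adjacencyAlgebra k) := by
  have := IsArtinianRing.of_finite k (C.adjacencyAlgebra k)
  refine IsArtinianRing.isSemisimpleRing_of_forall_isNilpotent_mul fun x hx => ?_
  refine (C.algebraBasis k).ext_elem fun S => ?_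
  -- Pairing `x` with the transpose of `S` isolates the coefficient of `x` at `S`, times a nonzero
  -- cardinality; nilpotent matrices have trace zero.
  have h := (Matrix.isNilpotent_trace_of_isNilpotent
    ((hx (C.algebraBasis k (C.transposeRel S))).map (C.toMatrix k))).eq_zero
  conv at h => enter [1, 1, 2, 2]; rw [← (C.algebraBasis k).sum_repr x]
  simp only [Finset.mul_sum, mul_smul_comm, map_sum, map_smul, Matrix.trace_sum,
    Matrix.trace_smul, trace_toMatrix_algebraBasis_mul, transposeRel_transposeRel] at h
  rw [Finset.sum_eq_single S (fun T _ hT => by simp [hT]) (by simp)] at h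
  simpa [C.card_ne_zero k] using h

/-- The Gram matrix of the trace form of the standard module has determinant `± ∏ |R|`. -/
theorem det_gram (k : Type*) [Field k] :
    (Matrix.of fun R S => (C.toMatrix k (C.algebraBasis k R * C.algebraBasis k S)).trace).det =
      (Equiv.Perm.sign C.transposeRel : ℤ) * ∏ R : C.rels, (R.1.card : k) := by
  have h : (Matrix.of fun R S => (C.toMatrix k (C.algebraBasis k R * C.algebraBasis k S)).trace) =
      (Matrix.diagonal fun R : C.rels => (R.1.card : k)).submatrix id C.transposeRel := by
    ext R S
    rw [Matrix.of_apply, trace_toMatrix_algebraBasis_mul, Matrix.submatrix_apply,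
      Matrix.diagonal_apply, id]
    have : S = C.transposeRel R ↔ R = C.transposeRel S := by
      constructor <;> rintro rfl <;> rw [transposeRel_transposeRel]
    simp only [this]
  rw [h, Matrix.det_permute', Matrix.det_diagonal]

noncomputable instance (k : Type*) [Field k] : Module k (C.StandardModule k) :=
  inferInstanceAs (Module k (V → k))

instance (k : Type*) [Field k] : Module.Finite k (C.StandardModule k) :=
  inferInstanceAs (Module.Finite k (V → k))

theorem standardModule_smul_def (k : Type*) [Field k] (a : (C.adjacencyAlgebra k)ᵐᵒᵖ)
    (x : C.StandardModule k) :
    a • x = Matrix.vecMul (show V → k from x) (C.toMatrix k a.unop) := rfl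

instance (k : Type*) [Field k] : IsScalarTower k (C.adjacencyAlgebra k)ᵐᵒᵖ (C.StandardModule k) where
  smul_assoc c a x := by
    rw [standardModule_smul_def, standardModule_smul_def, MulOpposite.unop_smul, map_smul]
    exact Matrix.vecMul_smul _ _ _

theorem trace_lsmul_standardModule (k : Type*) [Field k] (a : C.adjacencyAlgebra k) :
    LinearMap.trace k (C.StandardModule k)
      (Algebra.lsmul k k (C.StandardModule k) (MulOpposite.op a)) = (C.toMatrix k a).trace := by
  have h : Algebra.lsmul k k (C.StandardModule k) (MulOpposite.op a) =
      (show Module.End k (V → k) from Matrix.toLin' (C.toMatrix k a)ᵀ) := by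
    refine LinearMap.ext fun x => ?_
    exact (Matrix.mulVec_transpose (C.toMatrix k a) (show V → k from x)).symm
  rw [h, ← Matrix.trace_transpose (C.toMatrix k a)]
  exact Matrix.trace_toLin'_eq _

end CoherentConfiguration

/-! ### Integral representations and their reduction to the residue field. -/

section IntegralRepresentation

variable {O W : Type*} [CommRing O] [Ring W] {n : ℕ} {d : Fin n → ℕ}
  (ψ : ∀ j, W →+* Matrix (Fin (d j)) (Fin (d j)) O)

/-- The scalar extension of a family of matrix representations over `O` to an `O`-algebra `S`. -/
noncomputable def scalarExtension (S : Type*) [CommRing S] [Algebra O S] :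
    S ⊗[ℤ] W →ₐ[S] Π j, Matrix (Fin (d j)) (Fin (d j)) S :=
  Algebra.TensorProduct.lift (Algebra.ofId S _)
    (RingHom.toIntAlgHom (RingHom.pi fun j => ((algebraMap O S).mapMatrix).comp (ψ j)))
    fun a _ => by
      rw [Algebra.ofId_apply]
      exact Algebra.commute_algebraMap_left a _

theorem scalarExtension_tmul (S : Type*) [CommRing S] [Algebra O S] (s : S) (w : W) (j : Fin n) :
    scalarExtension ψ S (s ⊗ₜ w) j = s • (ψ j w).map (algebraMap O S) := by
  rw [scalarExtension, Algebra.TensorProduct.lift_tmul, Algebra.ofId_apply, ← Algebra.smul_def]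
  rfl

theorem scalarExtension_map {S : Type*} [CommRing S] [Algebra O S] (x : O ⊗[ℤ] W) (j : Fin n) :
    scalarExtension ψ S (Algebra.TensorProduct.map (RingHom.toIntAlgHom (algebraMap O S))
      (AlgHom.id ℤ W) x) j = (scalarExtension ψ O x j).map (algebraMap O S) := by
  induction x using TensorProduct.induction_on with
  | zero => simp
  | add x y hx hy =>
    rw [map_add, map_add, map_add, Pi.add_apply, Pi.add_apply, hx, hy,
      Matrix.map_add _ (map_add (algebraMap O S))]
  | tmul a w =>
    rw [Algebra.TensorProduct.map_tmul, scalarExtension_tmul, scalarExtension_tmul]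
    ext a b
    simp

/-- If the representations over `O` are jointly faithful, then the kernel of their reduction
consists of nilpotent elements. -/
theorem isNilpotent_of_scalarExtension_eq_zero {κ : Type*} [Field κ] [Algebra O κ]
    (hκ : Function.Surjective (algebraMap O κ))
    (hψ : Function.Injective (scalarExtension ψ O))
    {y : κ ⊗[ℤ] W}
    (hy : scalarExtension ψ κ y = 0) : IsNilpotent y := by
  let π := Algebra.TensorProduct.map (RingHom.toIntAlgHom (algebraMap O κ)) (AlgHom.id ℤ W)
  obtain ⟨x, rfl⟩ : ∃ x, π x = y :=
    TensorProduct.map_surjective (g := (RingHom.toIntAlgHom (algebraMap O κ)).toLinearMap)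
      (g' := (AlgHom.id ℤ W).toLinearMap) hκ Function.surjective_id y
  -- By Cayley–Hamilton `q` annihilates every component of the image of the lift `x`, hence `x`
  -- itself by faithfulness. Its reduction is a power of `X`, because the reduced matrices vanish.
  let q : Polynomial O := ∏ j, (scalarExtension ψ O x j).charpoly
  have hq : Polynomial.aeval x q = 0 := by
    apply hψ
    rw [map_zero, ← Polynomial.aeval_algHom_apply]
    ext j : 1
    have h : Polynomial.aeval (scalarExtension ψ O x) q j =
        Polynomial.aeval (scalarExtension ψ O x j) q :=
      (Polynomial.aeval_algHom_apply (Pi.evalAlgHom O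
        (fun j => Matrix (Fin (d j)) (Fin (d j)) O) j) (scalarExtension ψ O x) q).symm
    rw [h, Pi.zero_apply]
    obtain ⟨r, hr⟩ := Finset.dvd_prod_of_mem (fun j => (scalarExtension ψ O x j).charpoly)
      (Finset.mem_univ j)
    simp only [q]
    rw [hr, map_mul, Matrix.aeval_self_charpoly, zero_mul]
  have hmap : q.map (algebraMap O κ) = Polynomial.X ^ ∑ j, d j := by
    rw [Polynomial.map_prod, ← Finset.prod_pow_eq_pow_sum]
    refine Finset.prod_congr rfl fun j _ => ?_
    rw [← Matrix.charpoly_map]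
    have : (algebraMap O κ).mapMatrix (scalarExtension ψ O x j) = 0 := by
      have := congrFun hy j
      rwa [scalarExtension_map] at this
    rw [RingHom.mapMatrix_apply] at this
    rw [this, Matrix.charpoly_zero, Fintype.card_fin]
  refine ⟨∑ j, d j, ?_⟩
  have h := Polynomial.map_aeval_eq_aeval_map (φ := algebraMap O κ) (ψ := π.toRingHom)
    (by ext; simp [π, Algebra.TensorProduct.algebraMap_apply]) q x
  rw [hq, hmap, map_zero, map_pow, Polynomial.aeval_X] at h
  exact h.symm

theorem scalarExtension_injective {K : Type*} [Field K] [Algebra O K]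
    (hO : Function.Injective (algebraMap O K)) [Module.Flat ℤ W]
    (hK : Function.Injective (scalarExtension ψ K)) : Function.Injective (scalarExtension ψ O) := by
  have h1 : Function.Injective (Algebra.TensorProduct.map
      (RingHom.toIntAlgHom (algebraMap O K)) (AlgHom.id ℤ W)) :=
    Module.Flat.rTensor_preserves_injective_linearMap
      (RingHom.toIntAlgHom (algebraMap O K)).toLinearMap hO
  intro x y hxy
  apply h1
  apply hK
  ext j : 1
  rw [scalarExtension_map, scalarExtension_map, hxy]

/-- If matrix representations over `O` are jointly faithful, then the reduction of the algebra
to a residue field is semisimple precisely when it is mapped isomorphically. -/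
theorem isSemisimpleRing_iff_bijective_scalarExtension {κ : Type*} [Field κ] [Algebra O κ]
    (hκ : Function.Surjective (algebraMap O κ))
    (hψ : Function.Injective (scalarExtension ψ O)) [Module.Finite ℤ W]
    (hrank : Module.finrank κ (κ ⊗[ℤ] W) =
      Module.finrank κ
        (Π j, Matrix (Fin (d j)) (Fin (d j)) κ)) :
    IsSemisimpleRing (κ ⊗[ℤ] W) ↔
      Function.Bijective (scalarExtension ψ κ) := by
  constructor
  · intro _
    have hinj : Function.Injective (scalarExtension ψ κ) := by
      rw [injective_iff_map_eq_zero]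
      -- The kernel is an ideal of nilpotent elements, so it is zero in a semisimple ring.
      refine fun y hy => IsSemisimpleRing.eq_zero_of_forall_isNilpotent_mul fun a => ?_
      refine isNilpotent_of_scalarExtension_eq_zero ψ hκ hψ ?_
      rw [map_mul, hy, mul_zero]
    exact ⟨hinj, (LinearMap.injective_iff_surjective_of_finrank_eq_finrank
      (f := (scalarExtension ψ κ).toLinearMap) hrank).mp hinj⟩
  · intro h
    exact (AlgEquiv.ofBijective _ h).symm.toRingEquiv.isSemisimpleRing

/-- The standard basis of a product of matrix algebras. -/
noncomputable def piMatrixBasis (S : Type*) [CommRing S] (d : Fin n → ℕ) :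
    Module.Basis (Σ j, Fin (d j) × Fin (d j)) S (Π j, Matrix (Fin (d j)) (Fin (d j)) S) :=
  Pi.basis fun j => Matrix.stdBasis S (Fin (d j)) (Fin (d j))

theorem piMatrixBasis_repr (S : Type*) [CommRing S] (x : Π j, Matrix (Fin (d j)) (Fin (d j)) S)
    (t : Σ j, Fin (d j) × Fin (d j)) : (piMatrixBasis S d).repr x t = x t.1 t.2.1 t.2.2 := by
  rw [piMatrixBasis, Pi.basis_repr]
  rfl

/-- The matrix of entries of the values of representations at basis elements. -/
noncomputable def entryMatrix {ι : Type*} (b : Module.Basis ι ℤ W) (σ : ι ≃ Σ j, Fin (d j) × Fin (d j)) :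
    Matrix ι ι O :=
  Matrix.of fun s r => ψ (σ s).1 (b r) (σ s).2.1 (σ s).2.2

theorem toMatrix_scalarExtension {ι : Type*} [Fintype ι] [DecidableEq ι] (b : Module.Basis ι ℤ W)
    (σ : ι ≃ Σ j, Fin (d j) × Fin (d j)) (S : Type*) [CommRing S] [Algebra O S] :
    LinearMap.toMatrix (Algebra.TensorProduct.basis S b) ((piMatrixBasis S d).reindex σ.symm)
      (scalarExtension ψ S).toLinearMap = (entryMatrix ψ b σ).map (algebraMap O S) := by
  ext s r
  rw [LinearMap.toMatrix_apply, Module.Basis.repr_reindex_apply, Equiv.symm_symm,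
    piMatrixBasis_repr, Algebra.TensorProduct.basis_apply, AlgHom.toLinearMap_apply,
    scalarExtension_tmul, one_smul]
  rfl

theorem bijective_scalarExtension_iff {ι : Type*} [Fintype ι] [DecidableEq ι]
    (b : Module.Basis ι ℤ W) (σ : ι ≃ Σ j, Fin (d j) × Fin (d j)) (S : Type*) [CommRing S]
    [Algebra O S] :
    Function.Bijective (scalarExtension ψ S) ↔
      IsUnit (algebraMap O S (entryMatrix ψ b σ).det) := by
  rw [RingHom.map_det, RingHom.mapMatrix_apply, ← toMatrix_scalarExtension]
  constructor
  · intro h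
    exact (LinearEquiv.ofBijective (scalarExtension ψ S).toLinearMap h).isUnit_det _ _
  · intro h
    exact (LinearEquiv.ofIsUnitDet h).bijective

/-- The entry matrix represents the scalar extension over `κ` after reduction, and a local
homomorphism reflects units. -/
theorem isSemisimpleRing_iff_isUnit_det_entryMatrix {κ : Type*} [Field κ] [Algebra O κ]
    (hκ : Function.Surjective (algebraMap O κ)) [IsLocalHom (algebraMap O κ)]
    {ι : Type*} [Fintype ι] [DecidableEq ι]
    (b : Module.Basis ι ℤ W) (σ : ι ≃ Σ j, Fin (d j) × Fin (d j))
    (hψ : Function.Injective (scalarExtension ψ O)) :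
    IsSemisimpleRing (κ ⊗[ℤ] W) ↔ IsUnit (entryMatrix ψ b σ).det := by
  have : Module.Finite ℤ W := .of_basis b
  rw [isSemisimpleRing_iff_bijective_scalarExtension ψ hκ hψ, bijective_scalarExtension_iff ψ b σ]
  · exact isUnit_map_iff (algebraMap O κ) _
  · rw [Module.finrank_eq_card_basis (Algebra.TensorProduct.basis _ b),
      Module.finrank_eq_card_basis ((piMatrixBasis _ d).reindex σ.symm)]

end IntegralRepresentation

-- The Frame number as a determinant square, integrality and reduction.

universe u

namespace CoherentConfiguration

variable {V : Type*} [Fintype V] [DecidableEq V] (C : CoherentConfiguration V)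

/-- The adjacency algebra over `ℂ` is a product of matrix algebras in such a way that the adjacency
ring is mapped to matrices over a given valuation ring. -/
theorem exists_integral_algEquiv (O : ValuationSubring ℂ) :
    ∃ (n : ℕ) (d : Fin n → ℕ) (_ : ∀ j, NeZero (d j))
      (e : C.adjacencyAlgebra ℂ ≃ₐ[ℂ] Π j, Matrix (Fin (d j)) (Fin (d j)) ℂ)
      (ψ : ∀ j, C.adjacencyRing →+* Matrix (Fin (d j)) (Fin (d j)) O),
      ∀ x, scalarExtension ψ ℂ x = e x := by
  obtain ⟨n, d, hd, ⟨e⟩⟩ :=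
    IsSemisimpleRing.exists_algEquiv_pi_matrix_of_isAlgClosed ℂ (C.adjacencyAlgebra ℂ)
  let φ : ∀ j, C.adjacencyRing →+* Matrix (Fin (d j)) (Fin (d j)) ℂ := fun j =>
    (Pi.evalRingHom (fun j => Matrix (Fin (d j)) (Fin (d j)) ℂ) j).comp (e.toRingEquiv.toRingHom.comp
      (Algebra.TensorProduct.includeRight : C.adjacencyRing →ₐ[ℤ] C.adjacencyAlgebra ℂ).toRingHom)
  choose g ψ hψ using fun j => ValuationRing.exists_conj_integral O (φ j)
  let e' := e.trans (AlgEquiv.piCongrRight fun j =>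
    MulSemiringAction.toAlgEquiv ℂ (Matrix (Fin (d j)) (Fin (d j)) ℂ) (ConjAct.toConjAct (g j)))
  refine ⟨n, d, hd, e', ψ, fun x => ?_⟩
  suffices h : scalarExtension ψ ℂ = (e' : C.adjacencyAlgebra ℂ →ₐ[ℂ] _) from
    DFunLike.congr_fun h x
  refine Algebra.TensorProduct.ext (by ext) ?_
  refine AlgHom.ext fun w => ?_
  ext j : 1
  change scalarExtension ψ ℂ (1 ⊗ₜ w) j =
    ConjAct.toConjAct (g j) • e (1 ⊗ₜ w) j
  rw [scalarExtension_tmul, one_smul, ConjAct.units_smul_def, hψ]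
  rfl

/-- The anti-isomorphism with a product of matrix algebras obtained by transposing. -/
noncomputable def opEquiv {n : ℕ} {d : Fin n → ℕ}
    (e : C.adjacencyAlgebra ℂ ≃ₐ[ℂ] Π j, Matrix (Fin (d j)) (Fin (d j)) ℂ) :
    (C.adjacencyAlgebra ℂ)ᵐᵒᵖ ≃ₐ[ℂ] Π j, Matrix (Fin (d j)) (Fin (d j)) ℂ :=
  (AlgEquiv.op e).trans ((AlgEquiv.piMulOpposite ℂ _).trans
    (AlgEquiv.piCongrRight fun j => (Matrix.transposeAlgEquiv (Fin (d j)) ℂ ℂ).symm))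

theorem opEquiv_op {n : ℕ} {d : Fin n → ℕ}
    (e : C.adjacencyAlgebra ℂ ≃ₐ[ℂ] Π j, Matrix (Fin (d j)) (Fin (d j)) ℂ)
    (a : C.adjacencyAlgebra ℂ) (j : Fin n) : C.opEquiv e (MulOpposite.op a) j = (e a j)ᵀ := rfl

/-- The Frame number is, up to sign, the square of the determinant of the matrix of entries of
the irreducible representations. -/
theorem exists_frameNumber_eq_det_sq {O : ValuationSubring ℂ} {n : ℕ} {d : Fin n → ℕ}
    [∀ j, NeZero (d j)] (e : C.adjacencyAlgebra ℂ ≃ₐ[ℂ] Π j, Matrix (Fin (d j)) (Fin (d j)) ℂ)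
    (ψ : ∀ j, C.adjacencyRing →+* Matrix (Fin (d j)) (Fin (d j)) O)
    (he : ∀ x, scalarExtension ψ ℂ x = e x) (σ : C.rels ≃ Σ j, Fin (d j) × Fin (d j)) :
    ∃ ε : ℤˣ, (C.frameNumber : ℂ) =
      (ε : ℤ) * ((algebraMap O ℂ (entryMatrix ψ C.adjacencyBasis σ).det)) ^ 2 := by
  set P := entryMatrix ψ C.adjacencyBasis σ with hP
  set Q := P.map (algebraMap O ℂ) with hQ
  set m : Fin n → ℕ := fun j =>
    ((Equiv.ofBijective _ (Irr.factor_bijective (C.opEquiv e))).symm j).multiplicity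
      (C.StandardModule ℂ) with hm
  have hdet : algebraMap O ℂ P.det = Q.det := RingHom.map_det _ _
  have htr : ∀ a, (C.toMatrix ℂ a).trace = ∑ j, (m j : ℂ) * (e a j).trace := by
    intro a
    rw [← trace_lsmul_standardModule, trace_lsmul_eq_sum (C.opEquiv e)]
    refine Finset.sum_congr rfl fun j _ => ?_
    rw [opEquiv_op, Matrix.trace_transpose]
  let f : C.rels → (Σ j, Fin (d j) × Fin (d j)) → ℂ := fun r t =>
    e (C.algebraBasis ℂ r) t.1 t.2.1 t.2.2
  have hentry : ∀ s r, Q s r = f r (σ s) := by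
    intro s r
    simp only [f]
    rw [← he, algebraBasis_apply, scalarExtension_tmul, one_smul, hQ, hP]
    simp [entryMatrix]
  let swap : (Σ j, Fin (d j) × Fin (d j)) ≃ Σ j, Fin (d j) × Fin (d j) :=
    Equiv.sigmaCongrRight fun j => Equiv.prodComm _ _
  -- Exchanges row and column indices, as required by `tr (XY) = ∑ X_{ab} Y_{ba}`.
  let θ : Equiv.Perm C.rels := (σ.trans swap).trans σ.symm
  have hθ : ∀ s, σ (θ s) = ⟨(σ s).1, (σ s).2.2, (σ s).2.1⟩ := by
    intro s
    simp [θ, swap]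
    rfl
  have hgram : (Matrix.of fun R S =>
      (C.toMatrix ℂ (C.algebraBasis ℂ R * C.algebraBasis ℂ S)).trace) =
      Qᵀ * Matrix.diagonal (fun s => (m (σ s).1 : ℂ)) * Q.submatrix θ id := by
    ext R S
    rw [Matrix.of_apply, htr, Matrix.mul_apply]
    simp only [Matrix.mul_diagonal, Matrix.transpose_apply, Matrix.submatrix_apply, id, hentry, hθ]
    rw [Equiv.sum_comp σ fun t => f R t * (m t.1 : ℂ) * f S ⟨t.1, t.2.2, t.2.1⟩,
      Fintype.sum_sigma]
    refine Finset.sum_congr rfl fun j _ => ?_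
    rw [map_mul, Pi.mul_apply, Matrix.trace, Finset.mul_sum, Fintype.sum_prod_type]
    refine Finset.sum_congr rfl fun a _ => ?_
    rw [Matrix.diag_apply, Matrix.mul_apply, Finset.mul_sum]
    exact Finset.sum_congr rfl fun b _ => by ring
  have hprod : ∏ s, (m (σ s).1 : ℂ) = ∏ j, (m j : ℂ) ^ (d j) ^ 2 := by
    rw [Equiv.prod_comp σ fun t => (m t.1 : ℂ), Fintype.prod_sigma]
    refine Finset.prod_congr rfl fun j _ => ?_
    simp [sq]
  have hG := C.det_gram ℂ
  rw [hgram, Matrix.det_mul, Matrix.det_mul, Matrix.det_transpose, Matrix.det_diagonal,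
    Matrix.det_permute, hprod] at hG
  have hne : ∏ R : C.rels, (R.1.card : ℂ) ≠ 0 :=
    Finset.prod_ne_zero_iff.mpr fun R _ => C.card_ne_zero ℂ R
  have hsq : ∀ u : ℤˣ, ((u : ℤ) : ℂ) * ((u : ℤ) : ℂ) = 1 := by
    intro u
    rcases Int.units_eq_one_or u with rfl | rfl <;> simp
  -- Nondegeneracy of the trace form forces every irreducible module to occur in the standard
  -- module, so the division is legitimate.
  have hm0 : ∏ j, (m j : ℂ) ^ (d j) ^ 2 ≠ 0 := by
    intro h0
    rw [h0, mul_zero, zero_mul] at hG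
    have := hsq (Equiv.Perm.sign C.transposeRel)
    rcases mul_eq_zero.mp hG.symm with h | h
    · rw [h] at this; simp at this
    · exact hne h
  refine ⟨Equiv.Perm.sign C.transposeRel * Equiv.Perm.sign θ, ?_⟩
  have hF : (C.frameNumber : ℂ) =
      (∏ R : C.rels, (R.1.card : ℂ)) / ∏ j, (m j : ℂ) ^ (d j) ^ 2 := by
    rw [frameNumber, finprod_multiplicity_pow (C.opEquiv e), ← Finset.prod_coe_sort C.rels]
    push_cast
    rfl
  rw [hF, div_eq_iff hm0, hdet]
  calc ∏ R : C.rels, (R.1.card : ℂ)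
      = ((Equiv.Perm.sign C.transposeRel : ℤ) : ℂ) * ((Equiv.Perm.sign C.transposeRel : ℤ) *
        ∏ R : C.rels, (R.1.card : ℂ)) := by rw [← mul_assoc, hsq, one_mul]
    _ = _ := by
      rw [← hG]
      push_cast
      ring

/-- Over every prime there is a valuation ring of `ℂ`. -/
theorem _root_.exists_valuationSubring_natCast_mem_nonunits {p : ℕ} (hp : p.Prime) :
    ∃ O : ValuationSubring ℂ, (p : ℂ) ∈ O.nonunits := by
  -- The ideal generated by `p` in the copy of `ℤ` in `ℂ` is proper, hence contained in the nonunits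
  -- of some valuation ring.
  let A := (Int.castRingHom ℂ).range
  have hI : Ideal.span {(p : A)} ≠ ⊤ := by
    rw [Ne, Ideal.span_singleton_eq_top, isUnit_iff_exists_inv]
    rintro ⟨⟨_, a, rfl⟩, ha⟩
    have ha' : ((p * a : ℤ) : ℂ) = (1 : ℤ) := by
      have := congrArg Subtype.val ha
      push_cast
      exact this
    have : (p : ℤ) ∣ 1 := ⟨a, by exact_mod_cast ha'.symm⟩
    exact hp.one_lt.ne' (by exact_mod_cast Int.eq_one_of_dvd_one (by positivity) this)
  obtain ⟨O, -, hO⟩ := Ideal.image_subset_nonunits_valuationSubring _ hI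
  exact ⟨O, hO ⟨p, Ideal.mem_span_singleton_self _, by simp⟩⟩

/-- Over a valuation ring of `ℂ`, the Frame number is integral, and its reduction decides whether
the adjacency algebra over the residue field is semisimple. -/
theorem exists_frameNumber_eq_and_isSemisimpleRing_iff (O : ValuationSubring ℂ) (κ : Type*)
    [Field κ] [Algebra O κ] (hκ : Function.Surjective (algebraMap O κ))
    [IsLocalHom (algebraMap O κ)] :
    ∃ x : O, (x : ℂ) = C.frameNumber ∧ x ≠ 0 ∧
      (IsSemisimpleRing (C.adjacencyAlgebra κ) ↔ IsUnit x) := by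
  obtain ⟨n, d, hd, e, ψ, he⟩ := C.exists_integral_algEquiv O
  -- Two bases of one space have equally many elements: `|rels| = ∑ d_j²`. Any bijection will do.
  let σ : C.rels ≃ Σ j, Fin (d j) × Fin (d j) :=
    ((C.algebraBasis ℂ).map e.toLinearEquiv).indexEquiv (piMatrixBasis ℂ d)
  obtain ⟨ε, hε⟩ := C.exists_frameNumber_eq_det_sq e ψ he σ
  have hεu : IsUnit (((ε : ℤ) : O)) := ε.isUnit.map (Int.castRingHom O)
  refine ⟨(ε : ℤ) * (entryMatrix ψ C.adjacencyBasis σ).det ^ 2, ?_, ?_, ?_⟩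
  · rw [hε]
    push_cast
    rfl
  · refine mul_ne_zero hεu.ne_zero (pow_ne_zero 2 fun h0 => ?_)
    have hbij : Function.Bijective (scalarExtension ψ ℂ) := by
      rw [show ⇑(scalarExtension ψ ℂ) = e from funext he]
      exact e.bijective
    rw [bijective_scalarExtension_iff ψ C.adjacencyBasis σ, h0, map_zero] at hbij
    exact not_isUnit_zero hbij
  · have hinj : Function.Injective (scalarExtension ψ O) := by
      refine scalarExtension_injective (K := ℂ) ψ Subtype.val_injective ?_
      intro x y hxy
      rw [he, he] at hxy
      exact e.injective hxy
    rw [isSemisimpleRing_iff_isUnit_det_entryMatrix ψ hκ C.adjacencyBasis σ hinj,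
      IsUnit.mul_iff, isUnit_pow_iff two_ne_zero]
    simp [hεu]

/-- Semisimplicity of the adjacency algebra over a finite field is invariant under extensions. -/
theorem isSemisimpleRing_adjacencyAlgebra_iff_of_finite (F k : Type*) [Field F] [Finite F]
    [Field k] [Algebra F k] :
    IsSemisimpleRing (C.adjacencyAlgebra k) ↔ IsSemisimpleRing (C.adjacencyAlgebra F) := by
  let f : k ⊗[F] C.adjacencyAlgebra F ≃ₐ[k] C.adjacencyAlgebra k :=
    (Algebra.TensorProduct.assoc ℤ F k k F C.adjacencyRing).symm.trans
      (Algebra.TensorProduct.congr (Algebra.TensorProduct.rid F k k) AlgEquiv.refl)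
  rw [← RingEquiv.isSemisimpleRing_iff (R := k ⊗[F] C.adjacencyAlgebra F) f.toRingEquiv]
  exact ⟨fun _ => IsSemisimpleRing.of_tensorProduct F k _,
    fun _ => IsSemisimpleRing.tensorProduct_of_finite F k _⟩

/-- Semisimplicity of the adjacency algebra depends only on the characteristic. -/
theorem isSemisimpleRing_adjacencyAlgebra_iff_zmod (p : ℕ) [Fact p.Prime] (k : Type*) [Field k]
    [CharP k p] :
    IsSemisimpleRing (C.adjacencyAlgebra k) ↔ IsSemisimpleRing (C.adjacencyAlgebra (ZMod p)) :=
  let _ : Algebra (ZMod p) k := ZMod.algebra k p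
  C.isSemisimpleRing_adjacencyAlgebra_iff_of_finite (ZMod p) k

theorem _root_.ValuationSubring.isUnit_intCast_iff {K : Type*} [Field K] {O : ValuationSubring K}
    {p : ℕ} (hp : p.Prime) (hO : (p : K) ∈ O.nonunits) (a : ℤ) :
    IsUnit (a : O) ↔ ¬ (p : ℤ) ∣ a := by
  obtain ⟨hpO, hmem⟩ := ValuationSubring.mem_nonunits_iff_exists_mem_maximalIdeal.mp hO
  have hpmem : (p : O) ∈ IsLocalRing.maximalIdeal O := by
    rwa [show (p : O) = ⟨p, hpO⟩ from Subtype.ext rfl]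
  constructor
  · rintro hu ⟨b, rfl⟩
    refine (IsLocalRing.mem_maximalIdeal _).mp ?_ hu
    push_cast
    exact Ideal.mul_mem_right _ _ hpmem
  · intro h
    by_contra hu
    have ha : (a : O) ∈ IsLocalRing.maximalIdeal O := hu
    obtain ⟨u, v, huv⟩ := (Nat.prime_iff_prime_int.mp hp).coprime_iff_not_dvd.mpr h
    -- The Bézout relation would put `1` in the maximal ideal.
    have h1 : (1 : O) = u * p + v * a := by exact_mod_cast (congrArg (Int.cast : ℤ → O) huv).symm
    refine (Ideal.ne_top_iff_one _).mp (IsLocalRing.maximalIdeal.isMaximal O).ne_top ?_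
    rw [h1]
    exact Ideal.add_mem _ (Ideal.mul_mem_left _ _ hpmem) (Ideal.mul_mem_left _ _ ha)

theorem _root_.ValuationSubring.exists_residueField {K : Type u} [Field K]
    (O : ValuationSubring K) : ∃ (κ : Type u) (_ : Field κ) (_ : Algebra O κ),
      Function.Surjective (algebraMap O κ) ∧ IsLocalHom (algebraMap O κ) :=
  ⟨IsLocalRing.ResidueField O, inferInstance, inferInstance, IsLocalRing.residue_surjective,
    inferInstanceAs (IsLocalHom (IsLocalRing.residue O))⟩

theorem frameNumber_ne_zero : C.frameNumber ≠ 0 := by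
  -- No prime is involved, so the trivial valuation ring `ℂ` suffices.
  obtain ⟨κ, _, _, hκ, _⟩ := (⊤ : ValuationSubring ℂ).exists_residueField
  obtain ⟨x, hx, hne, -⟩ := C.exists_frameNumber_eq_and_isSemisimpleRing_iff ⊤ κ hκ
  intro h
  rw [h, Rat.cast_zero] at hx
  exact hne (Subtype.ext hx)

/-- If a prime `p` divided the denominator, then over `O` the numerator, a unit by coprimality,
would be a multiple of the nonunit denominator. -/
theorem frameNumber_den : C.frameNumber.den = 1 := by
  by_contra h
  obtain ⟨p, hp, hdvd⟩ := Nat.exists_prime_and_dvd h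
  obtain ⟨O, hO⟩ := exists_valuationSubring_natCast_mem_nonunits hp
  obtain ⟨κ, _, _, hκ, _⟩ := O.exists_residueField
  obtain ⟨x, hx, -⟩ := C.exists_frameNumber_eq_and_isSemisimpleRing_iff O κ hκ
  have hnum : IsUnit ((C.frameNumber.num : ℤ) : O) := by
    rw [ValuationSubring.isUnit_intCast_iff hp hO]
    intro hn
    have := Nat.dvd_gcd (Int.natCast_dvd.mp hn) hdvd
    rw [C.frameNumber.reduced] at this
    exact hp.one_lt.ne' (Nat.dvd_one.mp this)
  have hmul : ((C.frameNumber.num : ℤ) : O) = x * ((C.frameNumber.den : ℤ) : O) := by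
    apply Subtype.ext
    push_cast
    rw [hx]
    exact_mod_cast (Rat.mul_den_eq_num C.frameNumber).symm
  rw [hmul, IsUnit.mul_iff, ValuationSubring.isUnit_intCast_iff hp hO] at hnum
  exact hnum.2 (by exact_mod_cast hdvd)

end CoherentConfiguration

theorem theorem5p2 {V : Type*} [Fintype V] [DecidableEq V] (C : CoherentConfiguration V)
    {k : Type*} [Field k] (p : ℕ) [CharP k p] :
    ∃ n : ℤ, C.frameNumber = (n : ℚ) ∧
      (IsSemisimpleRing (C.adjacencyAlgebra k) ↔ ¬ (p : ℤ) ∣ n) := by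
  have hF : C.frameNumber = (C.frameNumber.num : ℚ) :=
    (Rat.den_eq_one_iff _).mp C.frameNumber_den |>.symm
  refine ⟨C.frameNumber.num, hF, ?_⟩
  rcases CharP.char_is_prime_or_zero k p with hp | rfl
  · have : Fact p.Prime := ⟨hp⟩
    obtain ⟨O, hO⟩ := exists_valuationSubring_natCast_mem_nonunits hp
    obtain ⟨κ, _, _, hκ, _⟩ := O.exists_residueField
    obtain ⟨x, hx, -, hiff⟩ := C.exists_frameNumber_eq_and_isSemisimpleRing_iff O κ hκ
    have hxn : x = (C.frameNumber.num : O) := by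
      apply Subtype.ext
      rw [hx, hF]
      simp
    have hpκ : CharP κ p := by
      rw [CharP.charP_iff_prime_eq_zero hp]
      have h := (ValuationSubring.isUnit_intCast_iff hp hO (p : ℤ)).not.mpr (by simp)
      rw [← isUnit_map_iff (algebraMap O κ), isUnit_iff_ne_zero, not_not] at h
      simpa using h
    -- Passes from `k` to `ZMod p` and from there up to the residue field `κ`, also of
    -- characteristic `p`.
    rw [C.isSemisimpleRing_adjacencyAlgebra_iff_zmod p k,
      ← C.isSemisimpleRing_adjacencyAlgebra_iff_zmod p κ, hiff, hxn,
      ValuationSubring.isUnit_intCast_iff hp hO]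
  -- For `p = 0` both sides hold: `0` divides only `0`, and the Frame number is nonzero.
  · have : CharZero k := CharP.charP_to_charZero k
    refine iff_of_true inferInstance ?_
    simpa using C.frameNumber_ne_zero
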